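/- **Setting.** Let $f:\mathbb R^D\times\mathbb R^I\to\mathbb R^O$, let $\mathcal X=\{x_1,\dots,x_N\}\subset\mathbb R^I$ be a finite data set with labels $y_1,\dots,y_N$, and let $u\mapsto\log p(y\mid u)$, $u\in\mathbb R^O$, be a log-likelihood, twice continuously differentiable in $u$ for $y=y_1,\dots,y_N$. Assume that for every $n$ the map $w\mapsto f(w,x_n)$ is differentiable with a Lipschitz Jacobian $w\mapsto J_w(x_n)\in\mathbb R^{O\times D}$. Put $H_w(x_n)=-\nabla_u^2\log p(y_n\mid u)|_{u=f(w,x_n)}$ (when this Hessian does not depend on the label, neither does anything below) and assume that it is positive semidefinite for all $w$ and $n$. Let $J_w\in\mathbb R^{NO\times D}$ be the stacking of the $J_w(x_n)$, let $H_w=\mathrm{diag}(H_w(x_1),\dots,H_w(x_N))$, and define $$\mathrm{GGN}_w=J_w^\top H_wJ_w,\qquad \mathrm{NTK}_w=H_w^{1/2}J_wJ_w^\top H_w^{1/2}.$$ Assume that there are constants $0<l\le L$ with $l\|v\|\le\|\mathrm{NTK}_w v\|\le L\|v\|$ for all $w\in\mathbb R^D$ and $v\in\mathbb R^{NO}$.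 **The two distances.** Let $$d_{f^*H}(w_0,w_1)=\inf_\gamma\int_0^1\sqrt{\gamma'(t)^\top\,\mathrm{GGN}_{\gamma(t)}\,\gamma'(t)}\,dt,$$ the infimum being over smooth curves $\gamma:[0,1]\to\mathbb R^D$ with $\gamma(0)=w_0$ and $\gamma(1)=w_1$. Write $w\sim w'$ if there is a piecewise differentiable $\gamma:[0,1]\to\mathbb R^D$ with $\gamma(0)=w$, $\gamma(1)=w'$ and $f(\gamma(t),x)=f(w,x)$ for all $t\in[0,1]$ and $x\in\mathcal X$. This is an equivalence relation; let $\mathcal P=\mathbb R^D/\sim$ and let $[w]$ be the class of $w$. Let $$d_{\mathcal P}([w],[w'])=\inf\{\|p_1-q_1\|+\dots+\|p_n-q_n\|\},$$ the infimum being over all $n\ge1$ and all $p_1,\dots,p_n,q_1,\dots,q_n\in\mathbb R^D$ with $[p_1]=[w]$, $[p_{i+1}]=[q_i]$ for $1\le i<n$, and $[q_n]=[w']$. **Theorem.** The distances $d_{f^*H}$ and $d_{\mathcal P}$ are topologically equivalent: for every $\epsilon>0$ there is a $\delta>0$ such that for all $w_0,w_1\in\mathbb R^D$ $$d_{\mathcal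 P}([w_0],[w_1])<\delta\implies d_{f^*H}(w_0,w_1)<\epsilon,\qquad d_{f^*H}(w_0,w_1)<\delta\implies d_{\mathcal P}([w_0],[w_1])<\epsilon.$$ More explicitly, for all $w_0,w_1\in\mathbb R^D$ and $\delta>0$ $$d_{\mathcal P}([w_0],[w_1])<\delta\implies d_{f^*H}(w_0,w_1)<3\sqrt L\,\delta,\qquad d_{f^*H}(w_0,w_1)<\delta\implies d_{\mathcal P}([w_0],[w_1])<\frac{6\,\delta}{\sqrt l}.$$ -/

import Mathlib

open Set
open scoped ContDiff MatrixOrder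

/-- Euclidean space `ℝⁿ`. -/
abbrev Vec (n : ℕ) : Type := EuclideanSpace ℝ (Fin n)

section Quotient

variable {D I O : ℕ}

/-- The `X`-reparameterizations of `w`: the parameters with the same predictions as `w` on `X`. -/
def reparam (f : Vec D → Vec I → Vec O) (X : Set (Vec I)) (w : Vec D) : Set (Vec D) :=
  {w' | ∀ x ∈ X, f w' x = f w x}

/-- `γ` is piecewise differentiable on `[0,1]`: there is a partition `0 = t₀ ≤ ⋯ ≤ tₖ = 1` such that
`γ` is differentiable on each closed piece `[tᵢ, tᵢ₊₁]` (one-sidedly at the end points of the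
piece). In particular `γ` is continuous on `[0,1]`. -/
def PiecewiseDifferentiable (γ : ℝ → Vec D) : Prop :=
  ∃ (k : ℕ) (t : ℕ → ℝ), t 0 = 0 ∧ t k = 1 ∧
    ∀ i < k, t i ≤ t (i + 1) ∧ DifferentiableOn ℝ γ (Icc (t i) (t (i + 1)))

/-- `γ` is a homotopy of `(w, w')`. -/
def IsHomotopy (γ : ℝ → Vec D) (w w' : Vec D) : Prop :=
  PiecewiseDifferentiable γ ∧ γ 0 = w ∧ γ 1 = w'

/-- The `X`-smooth-reparameterizations of `w`. -/
def smoothReparam (f : Vec D → Vec I → Vec O) (X : Set (Vec I)) (w : Vec D) : Set (Vec D) :=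
  {w' | ∃ γ : ℝ → Vec D, IsHomotopy γ w w' ∧ ∀ t ∈ Icc (0 : ℝ) 1, γ t ∈ reparam f X w}

theorem smoothReparam_refl (f : Vec D → Vec I → Vec O) (X : Set (Vec I)) (w : Vec D) :
    w ∈ smoothReparam f X w := by
  refine ⟨fun _ => w, ⟨⟨1, fun i => i, by simp, by simp, fun i _ => ⟨by simp, ?_⟩⟩, rfl, rfl⟩,
    fun t _ x _ => rfl⟩
  exact differentiableOn_const _

theorem PiecewiseDifferentiable.reverse {γ : ℝ → Vec D} (h : PiecewiseDifferentiable γ) :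
    PiecewiseDifferentiable (fun s => γ (1 - s)) := by
  obtain ⟨k, t, h0, h1, ht⟩ := h
  refine ⟨k, fun i => 1 - t (k - i), by simp [h1], by simp [h0], fun i hi => ?_⟩
  obtain ⟨hle, hd⟩ := ht (k - (i + 1)) (by omega)
  have e : k - (i + 1) + 1 = k - i := by omega
  rw [e] at hle hd
  refine ⟨by simp only; linarith, hd.comp (by fun_prop) ?_⟩
  intro s hs
  simp only [mem_Icc] at hs ⊢
  constructor <;> linarith [hs.1, hs.2]

theorem PiecewiseDifferentiable.concat {γ₁ γ₂ : ℝ → Vec D} (h₁ : PiecewiseDifferentiable γ₁)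
    (h₂ : PiecewiseDifferentiable γ₂) (h : γ₁ 1 = γ₂ 0) :
    PiecewiseDifferentiable (fun s => if s ≤ 1 / 2 then γ₁ (2 * s) else γ₂ (2 * s - 1)) := by
  obtain ⟨k₁, t₁, h10, h11, ht₁⟩ := h₁
  obtain ⟨k₂, t₂, h20, h21, ht₂⟩ := h₂
  have mono : ∀ i ≤ k₁, t₁ i ≤ 1 := by
    intro i hi
    rw [← h11]
    induction hi using Nat.decreasingInduction with
    | self => exact le_rfl
    | of_succ j hj ih => exact (ht₁ j (by omega)).1.trans ih
  have nonneg : ∀ i ≤ k₂, 0 ≤ t₂ i := by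
    intro i
    induction i with
    | zero => intro _; rw [h20]
    | succ j ih => intro hj; exact (ih (by omega)).trans (ht₂ j (by omega)).1
  refine ⟨k₁ + k₂, fun i => if i ≤ k₁ then t₁ i / 2 else (1 + t₂ (i - k₁)) / 2, by simp [h10], ?_, ?_⟩
  · by_cases hk : k₂ = 0
    · subst hk
      rw [h20] at h21
      norm_num at h21
    · have : ¬ (k₁ + k₂ ≤ k₁) := by omega
      simp only [this, if_false, Nat.add_sub_cancel_left, h21]
      norm_num
  · intro i hi
    by_cases hik : i < k₁
    · obtain ⟨hle, hd⟩ := ht₁ i hik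
      have a1 : i ≤ k₁ := hik.le
      have a2 : i + 1 ≤ k₁ := hik
      simp only [a1, a2, if_true]
      refine ⟨by linarith, ?_⟩
      have : DifferentiableOn ℝ (fun s => γ₁ (2 * s)) (Icc (t₁ i / 2) (t₁ (i + 1) / 2)) :=
        hd.comp (by fun_prop) (fun s hs => by
          simp only [mem_Icc] at hs ⊢
          constructor <;> linarith [hs.1, hs.2])
      refine this.congr fun s hs => ?_
      have : s ≤ 1 / 2 := by linarith [hs.2, mono (i + 1) a2]
      simp only [this, if_true]
    · obtain ⟨hle, hd⟩ := ht₂ (i - k₁) (by omega)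
      have a2 : ¬ (i + 1 ≤ k₁) := by omega
      have e : i + 1 - k₁ = i - k₁ + 1 := by omega
      have a1 : (if i ≤ k₁ then t₁ i / 2 else (1 + t₂ (i - k₁)) / 2) = (1 + t₂ (i - k₁)) / 2 := by
        split_ifs with hh
        · have : i = k₁ := by omega
          subst this
          rw [Nat.sub_self, h20, h11]
          norm_num
        · rfl
      simp only [a1, a2, if_false, e]
      refine ⟨by linarith, ?_⟩
      have : DifferentiableOn ℝ (fun s => γ₂ (2 * s - 1))
          (Icc ((1 + t₂ (i - k₁)) / 2) ((1 + t₂ (i - k₁ + 1)) / 2)) :=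
        hd.comp (by fun_prop) (fun s hs => by
          simp only [mem_Icc] at hs ⊢
          constructor <;> linarith [hs.1, hs.2])
      refine this.congr fun s hs => ?_
      have hs2 : 1 / 2 ≤ s := by linarith [hs.1, nonneg (i - k₁) (by omega)]
      split_ifs with hs1
      · have : s = 1 / 2 := le_antisymm hs1 hs2
        subst this
        norm_num [h]
      · rfl

/-- The relation `w ∼ w'`, i.e. `w'` is an `X`-smooth-reparameterization of `w`, is an equivalence
relation. -/
def reparamSetoid (f : Vec D → Vec I → Vec O) (X : Set (Vec I)) : Setoid (Vec D) where
  r w w' := w' ∈ smoothReparam f X w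
  iseqv :=
    { refl := smoothReparam_refl f X
      symm := by
        rintro w w' ⟨γ, ⟨hp, h0, h1⟩, hγ⟩
        refine ⟨fun s => γ (1 - s), ⟨hp.reverse, by simp [h1], by simp [h0]⟩, fun t ht x hx => ?_⟩
        have e1 := hγ (1 - t) ⟨by linarith [ht.2], by linarith [ht.1]⟩ x hx
        have e2 := hγ 1 ⟨by norm_num, le_rfl⟩ x hx
        rw [h1] at e2
        exact e1.trans e2.symm
      trans := by
        rintro a b c ⟨γ, ⟨hp, h0, h1⟩, hγ⟩ ⟨η, ⟨hq, g0, g1⟩, hη⟩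
        refine ⟨_, ⟨hp.concat hq (h1.trans g0.symm), by simp [h0], by norm_num [g1]⟩,
          fun t ht x hx => ?_⟩
        have e2 := hγ 1 ⟨by norm_num, le_rfl⟩ x hx
        rw [h1] at e2
        split_ifs with hs
        · exact hγ (2 * t) ⟨by linarith [ht.1], by linarith⟩ x hx
        · push Not at hs
          exact (hη (2 * t - 1) ⟨by linarith, by linarith [ht.2]⟩ x hx).trans e2 }

/-- The space `𝒫 = ℝᴰ / ∼` of effective parameters. -/
abbrev EffParam (f : Vec D → Vec I → Vec O) (X : Set (Vec I)) : Type :=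
  Quotient (reparamSetoid f X)

/-- The class `[w] ∈ 𝒫`. -/
abbrev effMk (f : Vec D → Vec I → Vec O) (X : Set (Vec I)) (w : Vec D) : EffParam f X :=
  Quotient.mk (reparamSetoid f X) w

/-- The quotient distance on `𝒫` inherited from the Euclidean distance: the infimum of
`‖p₁ - q₁‖ + ⋯ + ‖pₙ - qₙ‖` over all `n ≥ 1` and all `p, q` with `a = [p₁]`, `[pᵢ₊₁] = [qᵢ]`,
`[qₙ] = b`. -/
noncomputable def quotDist (f : Vec D → Vec I → Vec O) (X : Set (Vec I)) (a b : EffParam f X) : ℝ :=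
  sInf {s : ℝ | ∃ (n : ℕ) (p q : Fin (n + 1) → Vec D),
    effMk f X (p 0) = a ∧
    (∀ i : Fin n, effMk f X (p i.succ) = effMk f X (q i.castSucc)) ∧
    effMk f X (q (Fin.last n)) = b ∧
    s = ∑ i, ‖p i - q i‖}

end Quotient

section Pullback

variable {D I O N : ℕ} {Y : Type*}

/-- Minus the Hessian of `g : ℝᴼ → ℝ` at `u`. -/
noncomputable def negHessian (g : Vec O → ℝ) (u : Vec O) : Matrix (Fin O) (Fin O) ℝ :=
  Matrix.of fun i j =>
    -(fderiv ℝ (fderiv ℝ g) u (EuclideanSpace.single i 1) (EuclideanSpace.single j 1))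

/-- The stacked Jacobian `J_w ∈ ℝ^{NO × D}`; the row `(o, n)` is the derivative of the `o`-th
component of `w ↦ f (w, xₙ)`. -/
noncomputable def stackedJacobian (f : Vec D → Vec I → Vec O) (x : Fin N → Vec I) (w : Vec D) :
    Matrix (Fin O × Fin N) (Fin D) ℝ :=
  Matrix.of fun i d => fderiv ℝ (fun v => f v (x i.2)) w (EuclideanSpace.single d 1) i.1

/-- The block diagonal matrix `H_w = diag (H_w(x₁), …, H_w(x_N)) ∈ ℝ^{NO × NO}`, where
`H_w(xₙ)` is minus the Hessian of `u ↦ log p (yₙ | u)` at `u = f (w, xₙ)`. -/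
noncomputable def stackedHessian (f : Vec D → Vec I → Vec O) (logp : Y → Vec O → ℝ)
    (x : Fin N → Vec I) (y : Fin N → Y) (w : Vec D) : Matrix (Fin O × Fin N) (Fin O × Fin N) ℝ :=
  Matrix.blockDiagonal fun n => negHessian (logp (y n)) (f w (x n))

/-- The generalized Gauss-Newton matrix `Jᵀ H J`, which is the pullback pseudo-metric at `w`. -/
noncomputable def ggn (f : Vec D → Vec I → Vec O) (logp : Y → Vec O → ℝ)
    (x : Fin N → Vec I) (y : Fin N → Y) (w : Vec D) : Matrix (Fin D) (Fin D) ℝ :=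
  (stackedJacobian f x w).transpose * stackedHessian f logp x y w * stackedJacobian f x w

/-- The neural tangent kernel matrix `H^{1/2} J Jᵀ H^{1/2}`. -/
noncomputable def ntk (f : Vec D → Vec I → Vec O) (logp : Y → Vec O → ℝ)
    (x : Fin N → Vec I) (y : Fin N → Y) (w : Vec D) : Matrix (Fin O × Fin N) (Fin O × Fin N) ℝ :=
  CFC.sqrt (stackedHessian f logp x y w) * stackedJacobian f x w *
    (stackedJacobian f x w).transpose * CFC.sqrt (stackedHessian f logp x y w)

/-- The seminorm `‖v‖ = √(vᵀ · GGN_w · v)`. -/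
noncomputable def ggnNorm (f : Vec D → Vec I → Vec O) (logp : Y → Vec O → ℝ)
    (x : Fin N → Vec I) (y : Fin N → Y) (w v : Vec D) : ℝ :=
  √(v.ofLp ⬝ᵥ (ggn f logp x y w).mulVec v.ofLp)

/-- The length of a curve `γ : [0,1] → ℝᴰ` in the pullback pseudo-metric. -/
noncomputable def ggnLength (f : Vec D → Vec I → Vec O) (logp : Y → Vec O → ℝ)
    (x : Fin N → Vec I) (y : Fin N → Y) (γ : ℝ → Vec D) : ℝ :=
  ∫ t in (0 : ℝ)..1, ggnNorm f logp x y (γ t) (derivWithin γ (Icc 0 1) t)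

/-- The geodesic pseudo-distance: the infimum of the lengths of the smooth curves
`γ : [0,1] → ℝᴰ` from `w₀` to `w₁`. -/
noncomputable def geodDist (f : Vec D → Vec I → Vec O) (logp : Y → Vec O → ℝ)
    (x : Fin N → Vec I) (y : Fin N → Y) (w₀ w₁ : Vec D) : ℝ :=
  sInf {s : ℝ | ∃ γ : ℝ → Vec D, ContDiffOn ℝ ∞ γ (Icc 0 1) ∧ γ 0 = w₀ ∧ γ 1 = w₁ ∧
    s = ggnLength f logp x y γ}

end Pullback

/-! Write `F` for the stacked prediction map, `J` for its derivative and `S = √H`. With `B = S J`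
the kernel matrix is `B Bᵀ`, and positive semidefiniteness of `H` makes the pullback seminorm of `v`
equal to `‖B v‖`. The bounds on `B Bᵀ` therefore give `‖B v‖ ≤ √L ‖v‖`, and a right inverse `A` of
`J` with `‖A J v‖ ≤ ‖B v‖ / √l`; in particular `F` is a submersion.

The first bound gives `geodDist ≤ √L · quotDist`. A segment of a chain costs at most `√L` times its
Euclidean length, and a jump inside a class is free, because moving along a fibre of `F` does not
change the geodesic distance to a fixed point (`geodDist_eq_of_differentiableOn`). The triangle
inequality adds up the chain.

The second bound gives `quotDist ≤ geodDist / √l`. Near each point of a curve `γ`, other points can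
be slid along the fibres of `F` by a map with derivative `A J` (`exists_fibre_projection`). Sliding
keeps the classes and turns the velocity `γ'` into `A J γ'`, of norm at most the pullback seminorm
divided by `√l`. So the quotient distance from the start of `γ` grows no faster than the length
divided by `√l` (`quotDist_le_integral`). -/

open Filter Topology

/-! ### Singular value bounds from bounds on `B Bᵀ` -/

section LinearAlgebra

variable {E F : Type*} [NormedAddCommGroup E] [InnerProductSpace ℝ E] [FiniteDimensional ℝ E]
  [NormedAddCommGroup F] [InnerProductSpace ℝ F] [FiniteDimensional ℝ F]

theorem norm_sq_adjoint_le (B : E →ₗ[ℝ] F) (y : F) :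
    ‖B.adjoint y‖ ^ 2 ≤ ‖y‖ * ‖B (B.adjoint y)‖ := by
  rw [← real_inner_self_eq_norm_sq, LinearMap.adjoint_inner_left]
  exact real_inner_le_norm _ _

/-- Cauchy–Schwarz twice: `‖B v‖² = ⟪Bᵀ B v, v⟫`, and `norm_sq_adjoint_le` at `y = B v` bounds the
norm of `Bᵀ B v`. -/
theorem norm_le_sqrt_mul_of_norm_comp_adjoint_le (B : E →ₗ[ℝ] F) {L : ℝ}
    (h : ∀ y, ‖B (B.adjoint y)‖ ≤ L * ‖y‖) (v : E) : ‖B v‖ ≤ √L * ‖v‖ := by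
  have h1 : ‖B v‖ ^ 2 ≤ ‖B.adjoint (B v)‖ * ‖v‖ := by
    rw [← real_inner_self_eq_norm_sq, ← LinearMap.adjoint_inner_left]
    exact real_inner_le_norm _ _
  have h2 : ‖B.adjoint (B v)‖ ≤ √L * ‖B v‖ := by
    rcases eq_or_lt_of_le (norm_nonneg (B v)) with h0 | h0
    · rw [← h0, norm_eq_zero.1 h0.symm]
      simp
    have hL : 0 ≤ L := nonneg_of_mul_nonneg_left ((norm_nonneg _).trans (h (B v))) h0
    refine abs_le_of_sq_le_sq' ?_ (by positivity) |>.2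
    rw [mul_pow, Real.sq_sqrt hL]
    calc _ ≤ ‖B v‖ * ‖B (B.adjoint (B v))‖ := norm_sq_adjoint_le B (B v)
      _ ≤ ‖B v‖ * (L * ‖B v‖) := by gcongr; exact h _
      _ = L * ‖B v‖ ^ 2 := by ring
  rcases eq_or_lt_of_le (norm_nonneg (B v)) with h0 | h0
  · rw [← h0]
    positivity
  · refine le_of_mul_le_mul_left ?_ h0
    calc _ = ‖B v‖ ^ 2 := by ring
      _ ≤ ‖B.adjoint (B v)‖ * ‖v‖ := h1
      _ ≤ √L * ‖B v‖ * ‖v‖ := by gcongr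
      _ = _ := by ring

theorem norm_comp_le_sqrt_mul_of_norm_adjoint_le (J : E →ₗ[ℝ] F) (S : F →ₗ[ℝ] F) {L : ℝ}
    (h : ∀ y, ‖S (J ((S ∘ₗ J).adjoint y))‖ ≤ L * ‖y‖) (v : E) : ‖S (J v)‖ ≤ √L * ‖v‖ :=
  norm_le_sqrt_mul_of_norm_comp_adjoint_le (S ∘ₗ J) h v

theorem norm_adjoint_le_div_sqrt (B : E →ₗ[ℝ] F) {l : ℝ} (hl : 0 < l)
    (h : ∀ y, l * ‖y‖ ≤ ‖B (B.adjoint y)‖) (y : F) :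
    ‖B.adjoint y‖ ≤ ‖B (B.adjoint y)‖ / √l := by
  refine abs_le_of_sq_le_sq' ?_ (by positivity) |>.2
  rw [div_pow, Real.sq_sqrt hl.le, le_div_iff₀ hl]
  calc _ ≤ ‖y‖ * ‖B (B.adjoint y)‖ * l := by gcongr; exact norm_sq_adjoint_le B y
    _ = l * ‖y‖ * ‖B (B.adjoint y)‖ := by ring
    _ ≤ ‖B (B.adjoint y)‖ * ‖B (B.adjoint y)‖ := by gcongr; exact h y
    _ = _ := by ring

/-- If `S J (S J)ᵀ` is bounded below by `l`, then `J` has a right inverse `A` such that `A ∘ J` is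
controlled by the seminorm `‖S J v‖`. -/
theorem exists_rightInverse_norm_le (J : E →ₗ[ℝ] F) (S : F →ₗ[ℝ] F) {l : ℝ} (hl : 0 < l)
    (h : ∀ y, l * ‖y‖ ≤ ‖S (J ((S ∘ₗ J).adjoint y))‖) :
    ∃ A : F →ₗ[ℝ] E, (∀ u, J (A u) = u) ∧ ∀ v, ‖A (J v)‖ ≤ ‖S (J v)‖ / √l := by
  set B := S ∘ₗ J with hB
  have hinj : Function.Injective (B ∘ₗ B.adjoint) := by
    rw [injective_iff_map_eq_zero]
    intro y hy
    have h1 := h y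
    change B (B.adjoint y) = 0 at hy
    change _ ≤ ‖B (B.adjoint y)‖ at h1
    rw [hy, norm_zero] at h1
    exact norm_le_zero_iff.1 (nonpos_of_mul_nonpos_right h1 hl)
  let K := LinearEquiv.ofInjectiveEndo _ hinj
  have hK : ∀ z, B (B.adjoint (K.symm z)) = z := fun z => K.apply_symm_apply z
  -- Since `S J Bᵀ = B Bᵀ` is onto, so is `S`; being an endomorphism in finite dimension, it is also
  -- injective and can be cancelled.
  have hSsurj : Function.Surjective S := fun z => ⟨J (B.adjoint (K.symm z)), hK z⟩
  have hSinj : Function.Injective S := LinearMap.injective_iff_surjective.2 hSsurj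
  -- The right inverse is `A = Bᵀ (B Bᵀ)⁻¹ S`: `S J A u = S u`, and `S` cancels. Moreover `A J v =
  -- Bᵀ z` with `B Bᵀ z = B v`, so the previous bound applies to `z`.
  refine ⟨B.adjoint ∘ₗ K.symm.toLinearMap ∘ₗ S, fun u => hSinj (hK (S u)), fun v => ?_⟩
  have := norm_adjoint_le_div_sqrt B hl h (K.symm (S (J v)))
  rwa [hK] at this

end LinearAlgebra

/-! ### The prediction map and the pullback seminorm -/

section Regularity

variable {D I O N : ℕ} {Y : Type*}

/-- The vector of all predictions on the data set. -/
noncomputable def stackedPred (f : Vec D → Vec I → Vec O) (x : Fin N → Vec I) (w : Vec D) :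
    EuclideanSpace ℝ (Fin O × Fin N) :=
  WithLp.toLp 2 fun i => f w (x i.2) i.1

theorem mem_reparam_range_iff (f : Vec D → Vec I → Vec O) (x : Fin N → Vec I) (w w' : Vec D) :
    w' ∈ reparam f (range x) w ↔ stackedPred f x w' = stackedPred f x w := by
  constructor
  · intro h
    ext i
    exact congrArg (fun u : Vec O => u i.1) (h (x i.2) (mem_range_self _))
  · rintro h _ ⟨n, rfl⟩
    ext o
    exact congrArg (fun u : EuclideanSpace ℝ (Fin O × Fin N) => u (o, n)) h

theorem contDiff_stackedPred {f : Vec D → Vec I → Vec O} {x : Fin N → Vec I}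
    (hdiff : ∀ n, Differentiable ℝ (fun w => f w (x n)))
    (hcont : ∀ n, Continuous (fun w => fderiv ℝ (fun v => f v (x n)) w)) :
    ContDiff ℝ 1 (stackedPred f x) := by
  rw [contDiff_euclidean]
  intro i
  exact contDiff_euclidean.1 (contDiff_one_iff_fderiv.2 ⟨hdiff i.2, hcont i.2⟩) i.1

theorem toEuclideanLin_stackedJacobian {f : Vec D → Vec I → Vec O} {x : Fin N → Vec I}
    (hdiff : ∀ n, Differentiable ℝ (fun w => f w (x n))) (w : Vec D) :
    Matrix.toEuclideanLin (stackedJacobian f x w) = (fderiv ℝ (stackedPred f x) w : _ →ₗ[ℝ] _) := by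
  have hF : Differentiable ℝ (stackedPred f x) := by
    rw [differentiable_euclidean]
    intro i
    exact differentiable_euclidean.1 (hdiff i.2) i.1
  refine (EuclideanSpace.basisFun (Fin D) ℝ).toBasis.ext fun d => ?_
  ext i
  have h1 := hasFDerivWithinAt_euclidean.1 ((hF w).hasFDerivAt.hasFDerivWithinAt (s := univ)) i
  have h2 := hasFDerivWithinAt_euclidean.1
    ((hdiff i.2 w).hasFDerivAt.hasFDerivWithinAt (s := univ)) i.1
  have h3 := (hasFDerivWithinAt_univ.1 h1).unique (hasFDerivWithinAt_univ.1 h2)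
  have h4 := congrArg (fun T : Vec D →L[ℝ] ℝ => T (EuclideanSpace.single d 1)) h3
  simp only [ContinuousLinearMap.comp_apply, PiLp.proj_apply] at h4
  simp [stackedJacobian, Matrix.toLpLin_apply, h4]

theorem continuous_negHessian {g : Vec O → ℝ} (hg : ContDiff ℝ 2 g) :
    Continuous (negHessian g) := by
  have h : Continuous (fderiv ℝ (fderiv ℝ g)) :=
    (hg.fderiv_right (m := 1) (by norm_num)).continuous_fderiv (by norm_num)
  refine continuous_matrix fun i j => ?_
  exact ((h.clm_apply continuous_const).clm_apply continuous_const).neg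

theorem continuous_stackedHessian {f : Vec D → Vec I → Vec O} {logp : Y → Vec O → ℝ}
    {x : Fin N → Vec I} {y : Fin N → Y}
    (hdiff : ∀ n, Differentiable ℝ (fun w => f w (x n)))
    (hlogp : ∀ n, ContDiff ℝ 2 (logp (y n))) :
    Continuous (stackedHessian f logp x y) := by
  refine Continuous.matrix_blockDiagonal (continuous_pi fun n => ?_)
  exact (continuous_negHessian (hlogp n)).comp (hdiff n).continuous

/-- The block diagonal matrix `R` of the square roots of the blocks satisfies `M = Rᵀ R`. -/
theorem Matrix.PosSemidef.blockDiagonal_real {m n : Type*} [Fintype m] [DecidableEq m] [Fintype n]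
    [DecidableEq n] {M : n → Matrix m m ℝ} (h : ∀ k, (M k).PosSemidef) :
    (Matrix.blockDiagonal M).PosSemidef := by
  have e : Matrix.blockDiagonal M =
      (Matrix.blockDiagonal fun k => CFC.sqrt (M k)).conjTranspose *
        (Matrix.blockDiagonal fun k => CFC.sqrt (M k)) := by
    rw [Matrix.blockDiagonal_conjTranspose, ← Matrix.blockDiagonal_mul]
    congr 1
    ext1 k
    have hS : (CFC.sqrt (M k)).PosSemidef := Matrix.nonneg_iff_posSemidef.1 (CFC.sqrt_nonneg _)
    rw [hS.isHermitian.eq, CFC.sqrt_mul_sqrt_self _ (h k).nonneg]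
  rw [e]
  exact Matrix.posSemidef_conjTranspose_mul_self _

theorem isHermitian_sqrt {m : Type*} [Fintype m] [DecidableEq m] (M : Matrix m m ℝ) :
    (CFC.sqrt M).IsHermitian :=
  (Matrix.nonneg_iff_posSemidef.1 (CFC.sqrt_nonneg M)).isHermitian

theorem toEuclideanLin_ntk (f : Vec D → Vec I → Vec O) (logp : Y → Vec O → ℝ)
    (x : Fin N → Vec I) (y : Fin N → Y) (w : Vec D) :
    Matrix.toEuclideanLin (ntk f logp x y w) =
      (Matrix.toEuclideanLin (CFC.sqrt (stackedHessian f logp x y w)) ∘ₗ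
        Matrix.toEuclideanLin (stackedJacobian f x w)) ∘ₗ
      (Matrix.toEuclideanLin (CFC.sqrt (stackedHessian f logp x y w)) ∘ₗ
        Matrix.toEuclideanLin (stackedJacobian f x w)).adjoint := by
  set S := CFC.sqrt (stackedHessian f logp x y w) with hS
  have hSh : S.conjTranspose = S := isHermitian_sqrt _
  have hSJ : Matrix.toEuclideanLin S ∘ₗ Matrix.toEuclideanLin (stackedJacobian f x w) =
      Matrix.toEuclideanLin (S * stackedJacobian f x w) := (Matrix.toLpLin_mul_same _ _ _).symm
  rw [hSJ, ← Matrix.toEuclideanLin_conjTranspose_eq_adjoint]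
  refine Eq.trans ?_ (Matrix.toLpLin_mul_same _ _ _)
  rw [Matrix.conjTranspose_mul, hSh, Matrix.conjTranspose_eq_transpose_of_trivial, ntk, ← hS]
  simp only [Matrix.mul_assoc]

/-- This form contains no matrix square root, so continuity and local bounds of the seminorm follow
from those of `H` and `J` alone. -/
theorem ggnNorm_eq_sqrt_dotProduct {f : Vec D → Vec I → Vec O} (logp : Y → Vec O → ℝ)
    {x : Fin N → Vec I} (y : Fin N → Y)
    (hdiff : ∀ n, Differentiable ℝ (fun w => f w (x n))) (w v : Vec D) :
    ggnNorm f logp x y w v =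
      √((fderiv ℝ (stackedPred f x) w v).ofLp ⬝ᵥ
        (stackedHessian f logp x y w).mulVec (fderiv ℝ (stackedPred f x) w v).ofLp) := by
  have h : (fderiv ℝ (stackedPred f x) w v).ofLp = (stackedJacobian f x w).mulVec v.ofLp := by
    have := congrArg (fun T : Vec D →ₗ[ℝ] _ => (T v).ofLp) (toEuclideanLin_stackedJacobian hdiff w)
    exact this.symm
  rw [h, ggnNorm, ggn, ← Matrix.mulVec_mulVec, ← Matrix.mulVec_mulVec, Matrix.dotProduct_mulVec,
    Matrix.vecMul_transpose]

theorem ggnNorm_eq_norm {f : Vec D → Vec I → Vec O} {logp : Y → Vec O → ℝ}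
    {x : Fin N → Vec I} {y : Fin N → Y}
    (hdiff : ∀ n, Differentiable ℝ (fun w => f w (x n)))
    (hpsd : ∀ w n, (negHessian (logp (y n)) (f w (x n))).PosSemidef) (w v : Vec D) :
    ggnNorm f logp x y w v =
      ‖Matrix.toEuclideanLin (CFC.sqrt (stackedHessian f logp x y w))
        (fderiv ℝ (stackedPred f x) w v)‖ := by
  set u := fderiv ℝ (stackedPred f x) w v with hu
  have hH : (stackedHessian f logp x y w).PosSemidef :=
    Matrix.PosSemidef.blockDiagonal_real fun n => hpsd w n
  have hs := CFC.sqrt_mul_sqrt_self (stackedHessian f logp x y w) hH.nonneg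
  have hSh : (CFC.sqrt (stackedHessian f logp x y w)).transpose =
      CFC.sqrt (stackedHessian f logp x y w) := by
    rw [← Matrix.conjTranspose_eq_transpose_of_trivial]
    exact isHermitian_sqrt _
  rw [ggnNorm_eq_sqrt_dotProduct logp y hdiff, ← hu, norm_eq_sqrt_real_inner]
  congr 1
  generalize CFC.sqrt (stackedHessian f logp x y w) = S at hs hSh
  rw [← hs, EuclideanSpace.inner_eq_star_dotProduct, star_trivial, ← Matrix.mulVec_mulVec,
    Matrix.dotProduct_mulVec, ← Matrix.mulVec_transpose, hSh]
  rfl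

theorem ggnNorm_nonneg (f : Vec D → Vec I → Vec O) (logp : Y → Vec O → ℝ)
    (x : Fin N → Vec I) (y : Fin N → Y) (w v : Vec D) : 0 ≤ ggnNorm f logp x y w v :=
  Real.sqrt_nonneg _

theorem ggnNorm_smul (f : Vec D → Vec I → Vec O) (logp : Y → Vec O → ℝ)
    (x : Fin N → Vec I) (y : Fin N → Y) (w v : Vec D) {c : ℝ} (hc : 0 ≤ c) :
    ggnNorm f logp x y w (c • v) = c * ggnNorm f logp x y w v := by
  simp only [ggnNorm, WithLp.ofLp_smul, Matrix.mulVec_smul, dotProduct_smul, smul_dotProduct,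
    smul_eq_mul]
  rw [← mul_assoc, Real.sqrt_mul (by positivity), Real.sqrt_mul_self hc]

theorem continuous_ggnNorm {f : Vec D → Vec I → Vec O} {logp : Y → Vec O → ℝ}
    {x : Fin N → Vec I} {y : Fin N → Y}
    (hdiff : ∀ n, Differentiable ℝ (fun w => f w (x n)))
    (hcont : ∀ n, Continuous (fun w => fderiv ℝ (fun v => f v (x n)) w))
    (hlogp : ∀ n, ContDiff ℝ 2 (logp (y n))) :
    Continuous fun p : Vec D × Vec D => ggnNorm f logp x y p.1 p.2 := by
  simp only [ggnNorm_eq_sqrt_dotProduct logp y hdiff]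
  have hJ : Continuous (fderiv ℝ (stackedPred f x)) :=
    (contDiff_stackedPred hdiff hcont).continuous_fderiv (by norm_num)
  have hJv : Continuous fun p : Vec D × Vec D => (fderiv ℝ (stackedPred f x) p.1 p.2).ofLp :=
    (PiLp.continuous_ofLp 2 _).comp ((hJ.comp continuous_fst).clm_apply continuous_snd)
  exact (hJv.dotProduct
    (((continuous_stackedHessian hdiff hlogp).comp continuous_fst).matrix_mulVec hJv)).sqrt

theorem dotProduct_mulVec_self_le {m : Type*} [Fintype m] (M : Matrix m m ℝ)
    (u : EuclideanSpace ℝ m) :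
    u.ofLp ⬝ᵥ M.mulVec u.ofLp ≤ (∑ i, ∑ j, |M i j|) * ‖u‖ ^ 2 := by
  simp only [dotProduct, Matrix.mulVec, Finset.mul_sum, Finset.sum_mul]
  refine Finset.sum_le_sum fun i _ => Finset.sum_le_sum fun j _ => ?_
  calc u i * (M i j * u j) ≤ |u i * (M i j * u j)| := le_abs_self _
    _ = |M i j| * (‖u i‖ * ‖u j‖) := by
      rw [abs_mul, abs_mul, Real.norm_eq_abs, Real.norm_eq_abs]; ring
    _ ≤ |M i j| * (‖u‖ * ‖u‖) := by gcongr <;> exact PiLp.norm_apply_le u _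
    _ = _ := by ring

/-- Near every parameter the pullback seminorm is controlled by the Jacobian. -/
theorem eventually_ggnNorm_le {f : Vec D → Vec I → Vec O} {logp : Y → Vec O → ℝ}
    {x : Fin N → Vec I} {y : Fin N → Y}
    (hdiff : ∀ n, Differentiable ℝ (fun w => f w (x n)))
    (hlogp : ∀ n, ContDiff ℝ 2 (logp (y n))) (w₀ : Vec D) :
    ∃ C > 0, ∀ᶠ w in 𝓝 w₀, ∀ v,
      ggnNorm f logp x y w v ≤ C * ‖fderiv ℝ (stackedPred f x) w v‖ := by
  have hH := continuous_stackedHessian hdiff hlogp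
  have hc : Continuous fun w => ∑ i, ∑ j, |stackedHessian f logp x y w i j| :=
    continuous_finsetSum _ fun i _ => continuous_finsetSum _ fun j _ =>
      (hH.matrix_elem i j).abs
  set c := (∑ i, ∑ j, |stackedHessian f logp x y w₀ i j|) + 1 with hcdef
  have hc0 : 0 < c := by positivity
  refine ⟨√c, Real.sqrt_pos.2 hc0, ?_⟩
  filter_upwards [hc.continuousAt.eventually_lt_const (lt_add_one _)] with w hw v
  rw [ggnNorm_eq_sqrt_dotProduct logp y hdiff]
  refine Real.sqrt_le_iff.2 ⟨by positivity, ?_⟩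
  rw [mul_pow, Real.sq_sqrt hc0.le]
  refine (dotProduct_mulVec_self_le _ _).trans ?_
  gcongr

theorem ggnNorm_le_sqrt_mul_norm {f : Vec D → Vec I → Vec O} {logp : Y → Vec O → ℝ}
    {x : Fin N → Vec I} {y : Fin N → Y} {L : ℝ}
    (hdiff : ∀ n, Differentiable ℝ (fun w => f w (x n)))
    (hpsd : ∀ w n, (negHessian (logp (y n)) (f w (x n))).PosSemidef)
    (hntk : ∀ (w : Vec D) (v : EuclideanSpace ℝ (Fin O × Fin N)),
      ‖Matrix.toEuclideanLin (ntk f logp x y w) v‖ ≤ L * ‖v‖) (w v : Vec D) :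
    ggnNorm f logp x y w v ≤ √L * ‖v‖ := by
  have h := hntk w
  rw [toEuclideanLin_ntk, toEuclideanLin_stackedJacobian hdiff] at h
  rw [ggnNorm_eq_norm hdiff hpsd]
  generalize Matrix.toEuclideanLin (CFC.sqrt (stackedHessian f logp x y w)) = S at h ⊢
  generalize fderiv ℝ (stackedPred f x) w = J at h ⊢
  exact norm_comp_le_sqrt_mul_of_norm_adjoint_le _ S h v

theorem exists_rightInverse_norm_le_ggnNorm {f : Vec D → Vec I → Vec O} {logp : Y → Vec O → ℝ}
    {x : Fin N → Vec I} {y : Fin N → Y} {l : ℝ} (hl : 0 < l)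
    (hdiff : ∀ n, Differentiable ℝ (fun w => f w (x n)))
    (hpsd : ∀ w n, (negHessian (logp (y n)) (f w (x n))).PosSemidef)
    (hntk : ∀ (w : Vec D) (v : EuclideanSpace ℝ (Fin O × Fin N)),
      l * ‖v‖ ≤ ‖Matrix.toEuclideanLin (ntk f logp x y w) v‖) (w : Vec D) :
    ∃ A : EuclideanSpace ℝ (Fin O × Fin N) →L[ℝ] Vec D,
      (∀ u, fderiv ℝ (stackedPred f x) w (A u) = u) ∧
      ∀ v, ‖A (fderiv ℝ (stackedPred f x) w v)‖ ≤ ggnNorm f logp x y w v / √l := by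
  have h := hntk w
  rw [toEuclideanLin_ntk, toEuclideanLin_stackedJacobian hdiff] at h
  simp only [ggnNorm_eq_norm hdiff hpsd]
  generalize Matrix.toEuclideanLin (CFC.sqrt (stackedHessian f logp x y w)) = S at h ⊢
  obtain ⟨A, hA, hA'⟩ := exists_rightInverse_norm_le _ _ hl h
  exact ⟨A.toContinuousLinearMap, hA, hA'⟩

end Regularity

/-! ### Lengths, the geodesic distance and its invariance along fibres -/

section GeodDist

variable {D I O N : ℕ} {Y : Type*}

theorem ggnLength_nonneg (f : Vec D → Vec I → Vec O) (logp : Y → Vec O → ℝ)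
    (x : Fin N → Vec I) (y : Fin N → Y) (γ : ℝ → Vec D) : 0 ≤ ggnLength f logp x y γ :=
  intervalIntegral.integral_nonneg zero_le_one fun _ _ => ggnNorm_nonneg _ _ _ _ _ _

theorem bddBelow_ggnLength (f : Vec D → Vec I → Vec O) (logp : Y → Vec O → ℝ)
    (x : Fin N → Vec I) (y : Fin N → Y) (w₀ w₁ : Vec D) :
    BddBelow {s : ℝ | ∃ γ : ℝ → Vec D, ContDiffOn ℝ ∞ γ (Icc 0 1) ∧ γ 0 = w₀ ∧ γ 1 = w₁ ∧
      s = ggnLength f logp x y γ} := by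
  refine ⟨0, ?_⟩
  rintro s ⟨γ, -, -, -, rfl⟩
  exact ggnLength_nonneg _ _ _ _ _

theorem geodDist_le_ggnLength (f : Vec D → Vec I → Vec O) (logp : Y → Vec O → ℝ)
    (x : Fin N → Vec I) (y : Fin N → Y) {γ : ℝ → Vec D} (hγ : ContDiffOn ℝ ∞ γ (Icc 0 1)) :
    geodDist f logp x y (γ 0) (γ 1) ≤ ggnLength f logp x y γ :=
  csInf_le (bddBelow_ggnLength _ _ _ _ _ _) ⟨γ, hγ, rfl, rfl, rfl⟩

theorem contDiff_lineMap (a b : Vec D) :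
    ContDiff ℝ ∞ (AffineMap.lineMap a b : ℝ → Vec D) := by
  have : (AffineMap.lineMap a b : ℝ → Vec D) = fun t => t • (b - a) + a := by
    ext1 t
    exact AffineMap.lineMap_apply_module' a b t
  rw [this]
  fun_prop

theorem exists_curve_of_geodDist_lt {f : Vec D → Vec I → Vec O} {logp : Y → Vec O → ℝ}
    {x : Fin N → Vec I} {y : Fin N → Y} {w₀ w₁ : Vec D} {r : ℝ}
    (h : geodDist f logp x y w₀ w₁ < r) :
    ∃ γ : ℝ → Vec D, ContDiffOn ℝ ∞ γ (Icc 0 1) ∧ γ 0 = w₀ ∧ γ 1 = w₁ ∧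
      ggnLength f logp x y γ < r := by
  have hne : {s : ℝ | ∃ γ : ℝ → Vec D, ContDiffOn ℝ ∞ γ (Icc 0 1) ∧ γ 0 = w₀ ∧ γ 1 = w₁ ∧
      s = ggnLength f logp x y γ}.Nonempty :=
    ⟨_, AffineMap.lineMap w₀ w₁, (contDiff_lineMap _ _).contDiffOn, by simp, by simp, rfl⟩
  obtain ⟨s, ⟨γ, h1, h2, h3, rfl⟩, hs⟩ := exists_lt_of_csInf_lt hne h
  exact ⟨γ, h1, h2, h3, hs⟩

theorem geodDist_le_of_forall_segment {f : Vec D → Vec I → Vec O} {logp : Y → Vec O → ℝ}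
    {x : Fin N → Vec I} {y : Fin N → Y} {a b : Vec D} {C : ℝ}
    (h : ∀ z ∈ segment ℝ a b, ggnNorm f logp x y z (b - a) ≤ C) :
    geodDist f logp x y a b ≤ C := by
  have h1 := geodDist_le_ggnLength f logp x y (γ := AffineMap.lineMap a b)
    (contDiff_lineMap _ _).contDiffOn
  rw [AffineMap.lineMap_apply_zero, AffineMap.lineMap_apply_one] at h1
  refine h1.trans ((le_abs_self _).trans ?_)
  have h2 : ∀ t ∈ uIoc (0 : ℝ) 1, ‖ggnNorm f logp x y (AffineMap.lineMap a b t)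
      (derivWithin (AffineMap.lineMap a b) (Icc 0 1) t)‖ ≤ C := by
    intro t ht
    rw [uIoc_of_le zero_le_one] at ht
    have ht' : t ∈ Icc (0 : ℝ) 1 := ⟨ht.1.le, ht.2⟩
    rw [AffineMap.hasDerivWithinAt_lineMap.derivWithin (uniqueDiffOn_Icc zero_lt_one t ht'),
      Real.norm_of_nonneg (ggnNorm_nonneg _ _ _ _ _ _)]
    refine h _ ?_
    rw [segment_eq_image_lineMap]
    exact mem_image_of_mem _ ht'
  simpa [ggnLength] using intervalIntegral.norm_integral_le_of_norm_le_const h2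

theorem geodDist_le_mul_norm_sub {f : Vec D → Vec I → Vec O} {logp : Y → Vec O → ℝ}
    {x : Fin N → Vec I} {y : Fin N → Y} {C : ℝ}
    (h : ∀ w v, ggnNorm f logp x y w v ≤ C * ‖v‖) (a b : Vec D) :
    geodDist f logp x y a b ≤ C * ‖a - b‖ := by
  rw [norm_sub_rev]
  exact geodDist_le_of_forall_segment fun z _ => h z _

/-- Reparameterization invariance of the length, for a monotone smooth reparameterization. -/
theorem integral_ggnNorm_comp {f : Vec D → Vec I → Vec O} {logp : Y → Vec O → ℝ}
    {x : Fin N → Vec I} {y : Fin N → Y}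
    (hG : Continuous fun p : Vec D × Vec D => ggnNorm f logp x y p.1 p.2)
    {γ : ℝ → Vec D} (hγ : ContDiffOn ℝ ∞ γ (Icc 0 1)) {φ : ℝ → ℝ} (hφ : ContDiff ℝ ∞ φ)
    (hφI : ∀ t, φ t ∈ Icc (0 : ℝ) 1) (h0 : φ 0 = 0) (h1 : φ 1 = 1) :
    IntervalIntegrable (fun t => ggnNorm f logp x y (γ (φ t)) (derivWithin γ (Icc 0 1) (φ t)) *
      deriv φ t) MeasureTheory.volume 0 1 ∧
    ∫ t in (0 : ℝ)..1, ggnNorm f logp x y (γ (φ t)) (derivWithin γ (Icc 0 1) (φ t)) * deriv φ t =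
      ggnLength f logp x y γ := by
  have hg : ContinuousOn (fun t => ggnNorm f logp x y (γ t) (derivWithin γ (Icc 0 1) t))
      (Icc 0 1) :=
    hG.comp_continuousOn (hγ.continuousOn.prodMk
      (hγ.continuousOn_derivWithin (uniqueDiffOn_Icc zero_lt_one) (by norm_num)))
  have hφ' : Continuous (deriv φ) := hφ.continuous_deriv (by norm_num)
  constructor
  · refine Continuous.intervalIntegrable (Continuous.mul ?_ hφ') _ _
    exact hg.comp_continuous hφ.continuous hφI
  · have := intervalIntegral.integral_comp_mul_deriv' (a := 0) (b := 1)
      (fun t _ => (hφ.differentiable (by norm_num) t).hasDerivAt) hφ'.continuousOn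
      (hg.mono (image_subset_iff.2 fun t _ => hφI t))
    rw [h0, h1] at this
    exact this

/-- Admissible curves are smooth, so the concatenation must rest at the junction. Here `γ` is run
through during `[0, 1/3]` and `η` during `[2/3, 1]`, each with a smooth time change that is constant
outside its interval. -/
theorem geodDist_le_ggnLength_add {f : Vec D → Vec I → Vec O} {logp : Y → Vec O → ℝ}
    {x : Fin N → Vec I} {y : Fin N → Y}
    (hG : Continuous fun p : Vec D × Vec D => ggnNorm f logp x y p.1 p.2)
    {γ η : ℝ → Vec D} (hγ : ContDiffOn ℝ ∞ γ (Icc 0 1)) (hη : ContDiffOn ℝ ∞ η (Icc 0 1))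
    (h : γ 1 = η 0) :
    geodDist f logp x y (γ 0) (η 1) ≤ ggnLength f logp x y γ + ggnLength f logp x y η := by
  let φ : ℝ → ℝ := fun t => Real.smoothTransition (3 * t)
  let ψ : ℝ → ℝ := fun t => Real.smoothTransition (3 * t - 2)
  have hφ : ContDiff ℝ ∞ φ := Real.smoothTransition.contDiff.comp (by fun_prop)
  have hψ : ContDiff ℝ ∞ ψ := Real.smoothTransition.contDiff.comp (by fun_prop)
  have hφI : ∀ t, φ t ∈ Icc (0 : ℝ) 1 := fun t =>
    ⟨Real.smoothTransition.nonneg _, Real.smoothTransition.le_one _⟩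
  have hψI : ∀ t, ψ t ∈ Icc (0 : ℝ) 1 := fun t =>
    ⟨Real.smoothTransition.nonneg _, Real.smoothTransition.le_one _⟩
  have hφm : Monotone φ := fun s t hst => Real.smoothTransition.monotone (by linarith)
  have hψm : Monotone ψ := fun s t hst => Real.smoothTransition.monotone (by linarith)
  have hφ0 : φ 0 = 0 := by simp [φ]
  have hφ1 : ∀ t, 1 / 3 ≤ t → φ t = 1 := fun t ht =>
    Real.smoothTransition.one_of_one_le (by linarith)
  have hψ0 : ∀ t, t ≤ 2 / 3 → ψ t = 0 := fun t ht =>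
    Real.smoothTransition.zero_of_nonpos (by linarith)
  have hψ1 : ψ 1 = 1 := Real.smoothTransition.one_of_one_le (by norm_num)
  have hφd : ∀ t, 1 / 3 < t → deriv φ t = 0 := by
    intro t ht
    have : φ =ᶠ[𝓝 t] fun _ => 1 := by
      filter_upwards [lt_mem_nhds ht] with s hs using hφ1 s hs.le
    rw [this.deriv_eq, deriv_const]
  have hψd : ∀ t, t < 2 / 3 → deriv ψ t = 0 := by
    intro t ht
    have : ψ =ᶠ[𝓝 t] fun _ => 0 := by
      filter_upwards [gt_mem_nhds ht] with s hs using hψ0 s hs.le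
    rw [this.deriv_eq, deriv_const]
  -- As `θ` maps all of `ℝ` into `[0,1]`, the derivative of `ζ` within `[0,1]` yields a two-sided
  -- derivative of `ζ ∘ θ`.
  have hderiv : ∀ {ζ : ℝ → Vec D} {θ : ℝ → ℝ}, ContDiffOn ℝ ∞ ζ (Icc 0 1) → ContDiff ℝ ∞ θ →
      (∀ t, θ t ∈ Icc (0 : ℝ) 1) → ∀ t,
      HasDerivAt (fun s => ζ (θ s)) (deriv θ t • derivWithin ζ (Icc 0 1) (θ t)) t := by
    intro ζ θ hζ hθ hθI t
    have h1 := (hζ.differentiableOn (by norm_num) _ (hθI t)).hasDerivWithinAt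
    have h2 := (hθ.differentiable (by norm_num) t).hasDerivAt.hasDerivWithinAt (s := univ)
    exact (h1.scomp t h2 fun s _ => hθI s).hasDerivAt univ_mem
  -- A sum instead of a case distinction: smoothness is immediate, and at every time one of the two
  -- terms is constant, equal to `γ 1 = η 0`.
  let Γ : ℝ → Vec D := fun t => γ (φ t) + η (ψ t) - η 0
  have hΓ : ContDiff ℝ ∞ Γ := by
    have h1 : ContDiff ℝ ∞ fun t => γ (φ t) :=
      contDiffOn_univ.1 (hγ.comp hφ.contDiffOn fun t _ => hφI t)
    have h2 : ContDiff ℝ ∞ fun t => η (ψ t) :=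
      contDiffOn_univ.1 (hη.comp hψ.contDiffOn fun t _ => hψI t)
    exact (h1.add h2).sub contDiff_const
  have hΓ0 : Γ 0 = γ 0 := by simp [Γ, hφ0, hψ0 0 (by norm_num)]
  have hΓ1 : Γ 1 = η 1 := by simp [Γ, hφ1 1 (by norm_num), hψ1, h]
  have hΓd : ∀ t, HasDerivAt Γ (deriv φ t • derivWithin γ (Icc 0 1) (φ t) +
      deriv ψ t • derivWithin η (Icc 0 1) (ψ t)) t := fun t =>
    ((hderiv hγ hφ hφI t).add (hderiv hη hψ hψI t)).sub_const _
  obtain ⟨i1, e1⟩ := integral_ggnNorm_comp hG hγ hφ hφI hφ0 (hφ1 1 (by norm_num))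
  obtain ⟨i2, e2⟩ := integral_ggnNorm_comp hG hη hψ hψI (hψ0 0 (by norm_num)) hψ1
  rw [← e1, ← e2, ← intervalIntegral.integral_add i1 i2, ← hΓ0, ← hΓ1]
  refine (geodDist_le_ggnLength f logp x y hΓ.contDiffOn).trans_eq ?_
  refine intervalIntegral.integral_congr fun t ht => ?_
  rw [uIcc_of_le zero_le_one] at ht
  rw [(hΓd t).hasDerivWithinAt.derivWithin (uniqueDiffOn_Icc zero_lt_one t ht)]
  rcases le_total t (1 / 2) with ht2 | ht2
  · have e : Γ t = γ (φ t) := by simp [Γ, hψ0 t (by linarith)]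
    rw [hψd t (by linarith), zero_smul, add_zero, mul_zero, add_zero, e,
      ggnNorm_smul _ _ _ _ _ _ hφm.deriv_nonneg, mul_comm]
  · have e : Γ t = η (ψ t) := by simp [Γ, hφ1 t (by linarith), h]
    rw [hφd t (by linarith), zero_smul, zero_add, mul_zero, zero_add, e,
      ggnNorm_smul _ _ _ _ _ _ hψm.deriv_nonneg, mul_comm]

theorem geodDist_triangle {f : Vec D → Vec I → Vec O} {logp : Y → Vec O → ℝ}
    {x : Fin N → Vec I} {y : Fin N → Y}
    (hG : Continuous fun p : Vec D × Vec D => ggnNorm f logp x y p.1 p.2) (a b c : Vec D) :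
    geodDist f logp x y a c ≤ geodDist f logp x y a b + geodDist f logp x y b c := by
  refine le_of_forall_pos_lt_add fun ε hε => ?_
  obtain ⟨γ, hγ, rfl, rfl, hγl⟩ :=
    exists_curve_of_geodDist_lt (lt_add_of_pos_right (geodDist f logp x y a b) (half_pos hε))
  obtain ⟨η, hη, h0, rfl, hηl⟩ :=
    exists_curve_of_geodDist_lt (lt_add_of_pos_right (geodDist f logp x y (γ 1) c) (half_pos hε))
  linarith [geodDist_le_ggnLength_add hG hγ hη h0.symm]

/-- Nearby points of the same fibre of the prediction map are at distance `o(‖b - a‖)`. -/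
theorem eventually_geodDist_le_of_stackedPred_eq {f : Vec D → Vec I → Vec O}
    {logp : Y → Vec O → ℝ} {x : Fin N → Vec I} {y : Fin N → Y}
    (hdiff : ∀ n, Differentiable ℝ (fun w => f w (x n)))
    (hcont : ∀ n, Continuous (fun w => fderiv ℝ (fun v => f v (x n)) w))
    (hlogp : ∀ n, ContDiff ℝ 2 (logp (y n))) (w₀ : Vec D) {ε : ℝ} (hε : 0 < ε) :
    ∃ r > 0, ∀ a ∈ Metric.ball w₀ r, ∀ b ∈ Metric.ball w₀ r,
      stackedPred f x a = stackedPred f x b → geodDist f logp x y a b ≤ ε * ‖b - a‖ := by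
  obtain ⟨C, hC, hCw⟩ := eventually_ggnNorm_le hdiff hlogp w₀
  have hF := contDiff_stackedPred hdiff hcont
  set J := fderiv ℝ (stackedPred f x) with hJdef
  have hJ : Continuous J := hF.continuous_fderiv (by norm_num)
  have hJw : ∀ᶠ w in 𝓝 w₀, ‖J w - J w₀‖ < ε / (2 * C) := by
    have : Tendsto (fun w => ‖J w - J w₀‖) (𝓝 w₀) (𝓝 0) := by
      have := ((hJ.sub continuous_const).norm (f := fun w => J w - J w₀)).tendsto w₀
      simpa using this
    exact this.eventually_lt_const (by positivity)
  obtain ⟨r, hr, hball⟩ := Metric.eventually_nhds_iff_ball.1 (hCw.and hJw)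
  refine ⟨r, hr, fun a ha b hb hab => geodDist_le_of_forall_segment fun z hz => ?_⟩
  have hz' : z ∈ Metric.ball w₀ r := (convex_ball w₀ r).segment_subset ha hb hz
  -- The mean value inequality for `F - J w₀`. Since `F a = F b`, it says that `J w₀` nearly kills
  -- `b - a`; hence so does `J z` on the whole segment.
  have h1 := (convex_ball w₀ r).norm_image_sub_le_of_norm_fderiv_le' (𝕜 := ℝ)
    (fun w _ => hF.differentiable (by norm_num) w) (fun w hw => (hball w hw).2.le) ha hb
  rw [hab, sub_self, zero_sub, norm_neg] at h1
  have h2 : ‖J z (b - a)‖ ≤ ε / C * ‖b - a‖ := by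
    calc _ = ‖(J z - J w₀) (b - a) + J w₀ (b - a)‖ := by simp
      _ ≤ ‖J z - J w₀‖ * ‖b - a‖ + ‖J w₀ (b - a)‖ :=
        (norm_add_le _ _).trans (by gcongr; exact ContinuousLinearMap.le_opNorm _ _)
      _ ≤ ε / (2 * C) * ‖b - a‖ + ε / (2 * C) * ‖b - a‖ := by
        gcongr; exact (hball z hz').2.le
      _ = _ := by field_simp; ring
  calc _ ≤ C * ‖J z (b - a)‖ := (hball z hz').1 _
    _ ≤ C * (ε / C * ‖b - a‖) := by gcongr
    _ = _ := by field_simp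

/-- The geodesic distance to a fixed point does not change along a differentiable curve in a
fibre of the prediction map. -/
theorem geodDist_eq_of_differentiableOn {f : Vec D → Vec I → Vec O}
    {logp : Y → Vec O → ℝ} {x : Fin N → Vec I} {y : Fin N → Y}
    (hdiff : ∀ n, Differentiable ℝ (fun w => f w (x n)))
    (hcont : ∀ n, Continuous (fun w => fderiv ℝ (fun v => f v (x n)) w))
    (hlogp : ∀ n, ContDiff ℝ 2 (logp (y n))) (u : Vec D) {γ : ℝ → Vec D} {a b : ℝ} (hab : a ≤ b)
    (hγ : DifferentiableOn ℝ γ (Icc a b))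
    (hfib : ∀ t ∈ Icc a b, stackedPred f x (γ t) = stackedPred f x (γ a)) :
    geodDist f logp x y u (γ b) = geodDist f logp x y u (γ a) := by
  have hG := continuous_ggnNorm hdiff hcont hlogp
  set g := fun t => geodDist f logp x y u (γ t) with hg
  -- The curve is merely differentiable, so it need not be admissible for the geodesic distance and
  -- its length is not used. Instead, `|g s - g t|` is bounded by the distances between `γ s` and `γ
  -- t`, which are `o(‖γ s - γ t‖)` in a fibre, hence `o(|s - t|)`.
  have hd : ∀ t ∈ Icc a b, HasDerivWithinAt g 0 (Icc a b) t := by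
    intro t ht
    obtain ⟨K, hK, hKb⟩ := (hγ t ht).hasDerivWithinAt.isBigO_sub.exists_pos
    rw [hasDerivWithinAt_iff_isLittleO]
    refine Asymptotics.IsLittleO.of_bound fun c hc => ?_
    obtain ⟨r, hr, hloc⟩ := eventually_geodDist_le_of_stackedPred_eq (logp := logp) (y := y)
      hdiff hcont hlogp (γ t) (div_pos hc hK)
    filter_upwards [(hγ t ht).continuousWithinAt (Metric.ball_mem_nhds _ hr),
      (tendsto_id.prodMk (tendsto_const_pure (b := t))).eventually hKb.bound, self_mem_nhdsWithin] with s hs hsK hsI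
    have e : stackedPred f x (γ s) = stackedPred f x (γ t) := (hfib s hsI).trans (hfib t ht).symm
    have h1 := hloc _ hs _ (Metric.mem_ball_self hr) e
    have h2 := hloc _ (Metric.mem_ball_self hr) _ hs e.symm
    have h3 := geodDist_triangle hG u (γ s) (γ t)
    have h4 := geodDist_triangle hG u (γ t) (γ s)
    rw [norm_sub_rev] at h1
    have h5 : c / K * ‖γ s - γ t‖ ≤ c * ‖s - t‖ := by
      calc _ ≤ c / K * (K * ‖s - t‖) := by gcongr; exact hsK
        _ = _ := by field_simp
    rw [smul_zero, sub_zero, Real.norm_eq_abs, abs_le]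
    constructor <;> simp only [hg] <;> linarith
  exact constant_of_has_deriv_right_zero (fun t ht => (hd t ht).continuousWithinAt)
    (fun t ht => ((hd t (Ico_subset_Icc_self ht)).mono_of_mem_nhdsWithin
      (Icc_mem_nhdsGE_of_mem ht))) b (right_mem_Icc.2 hab)

theorem geodDist_eq_of_mem_smoothReparam {f : Vec D → Vec I → Vec O}
    {logp : Y → Vec O → ℝ} {x : Fin N → Vec I} {y : Fin N → Y}
    (hdiff : ∀ n, Differentiable ℝ (fun w => f w (x n)))
    (hcont : ∀ n, Continuous (fun w => fderiv ℝ (fun v => f v (x n)) w))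
    (hlogp : ∀ n, ContDiff ℝ 2 (logp (y n))) (u : Vec D) {w w' : Vec D}
    (h : w' ∈ smoothReparam f (range x) w) :
    geodDist f logp x y u w' = geodDist f logp x y u w := by
  obtain ⟨γ, ⟨⟨k, t, ht0, htk, ht⟩, rfl, rfl⟩, hγ⟩ := h
  have hnonneg : ∀ i ≤ k, 0 ≤ t i := by
    intro i
    induction i with
    | zero => intro _; rw [ht0]
    | succ j ih => intro hj; exact (ih (by omega)).trans (ht j hj).1
  have hle : ∀ i ≤ k, t i ≤ 1 := by
    intro i hi
    rw [← htk]
    induction hi using Nat.decreasingInduction with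
    | self => exact le_rfl
    | of_succ j hj ih => exact (ht j hj).1.trans ih
  have hF : ∀ s ∈ Icc (0 : ℝ) 1, stackedPred f x (γ s) = stackedPred f x (γ 0) := fun s hs =>
    (mem_reparam_range_iff f x _ _).1 (hγ s hs)
  have key : ∀ i ≤ k, geodDist f logp x y u (γ (t i)) = geodDist f logp x y u (γ 0) := by
    intro i
    induction i with
    | zero => intro _; rw [ht0]
    | succ j ih =>
      intro hj
      rw [← ih (by omega)]
      refine geodDist_eq_of_differentiableOn hdiff hcont hlogp u (ht j hj).1 (ht j hj).2 ?_
      intro s hs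
      have h0 := hnonneg j (by omega)
      have h1 := hle (j + 1) hj
      rw [hF s ⟨h0.trans hs.1, hs.2.trans h1⟩, hF (t j) ⟨h0, (ht j hj).1.trans h1⟩]
  rw [← htk]
  exact key k le_rfl

theorem geodDist_eq_of_effMk_eq {f : Vec D → Vec I → Vec O}
    {logp : Y → Vec O → ℝ} {x : Fin N → Vec I} {y : Fin N → Y}
    (hdiff : ∀ n, Differentiable ℝ (fun w => f w (x n)))
    (hcont : ∀ n, Continuous (fun w => fderiv ℝ (fun v => f v (x n)) w))
    (hlogp : ∀ n, ContDiff ℝ 2 (logp (y n))) (u : Vec D) {w w' : Vec D}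
    (h : effMk f (range x) w = effMk f (range x) w') :
    geodDist f logp x y u w' = geodDist f logp x y u w :=
  geodDist_eq_of_mem_smoothReparam hdiff hcont hlogp u (Quotient.exact h)

theorem geodDist_self_nonpos (f : Vec D → Vec I → Vec O) (logp : Y → Vec O → ℝ)
    (x : Fin N → Vec I) (y : Fin N → Y) (w : Vec D) : geodDist f logp x y w w ≤ 0 :=
  geodDist_le_of_forall_segment fun z _ => by simp [ggnNorm]

theorem geodDist_le_mul_quotDist {f : Vec D → Vec I → Vec O}
    {logp : Y → Vec O → ℝ} {x : Fin N → Vec I} {y : Fin N → Y} {C : ℝ} (hC : 0 ≤ C)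
    (hdiff : ∀ n, Differentiable ℝ (fun w => f w (x n)))
    (hcont : ∀ n, Continuous (fun w => fderiv ℝ (fun v => f v (x n)) w))
    (hlogp : ∀ n, ContDiff ℝ 2 (logp (y n)))
    (hbound : ∀ w v, ggnNorm f logp x y w v ≤ C * ‖v‖) (w₀ w₁ : Vec D) :
    geodDist f logp x y w₀ w₁ ≤
      C * quotDist f (range x) (effMk f (range x) w₀) (effMk f (range x) w₁) := by
  have hG := continuous_ggnNorm hdiff hcont hlogp
  -- The last point of the chain is left free, so that the induction can remove the last link.
  have key : ∀ (n : ℕ) (p q : Fin (n + 1) → Vec D), effMk f (range x) (p 0) = effMk f (range x) w₀ →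
      (∀ i : Fin n, effMk f (range x) (p i.succ) = effMk f (range x) (q i.castSucc)) →
      geodDist f logp x y w₀ (q (Fin.last n)) ≤ C * ∑ i, ‖p i - q i‖ := by
    intro n
    induction n with
    | zero =>
      intro p q hp _
      have h1 := geodDist_triangle hG w₀ (p 0) (q 0)
      have h2 := geodDist_eq_of_effMk_eq hdiff hcont hlogp (logp := logp) (y := y) w₀ hp
      have h3 := geodDist_self_nonpos f logp x y w₀
      have h4 := geodDist_le_mul_norm_sub hbound (p 0) (q 0)
      rw [Fin.sum_univ_one]
      change geodDist f logp x y w₀ (q 0) ≤ _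
      linarith
    | succ n ih =>
      intro p q hp hpq
      have h0 := ih (fun i => p i.castSucc) (fun i => q i.castSucc) hp
        (fun i => hpq i.castSucc)
      have h1 := geodDist_triangle hG w₀ (p (Fin.last _)) (q (Fin.last _))
      have h2 := geodDist_eq_of_effMk_eq hdiff hcont hlogp (logp := logp) (y := y) w₀
        (hpq (Fin.last n))
      have h4 := geodDist_le_mul_norm_sub hbound (p (Fin.last _)) (q (Fin.last _))
      rw [Fin.succ_last] at h2
      rw [Fin.sum_univ_castSucc, mul_add]
      linarith
  have hle : ∀ s, (∃ (n : ℕ) (p q : Fin (n + 1) → Vec D),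
      effMk f (range x) (p 0) = effMk f (range x) w₀ ∧
      (∀ i : Fin n, effMk f (range x) (p i.succ) = effMk f (range x) (q i.castSucc)) ∧
      effMk f (range x) (q (Fin.last n)) = effMk f (range x) w₁ ∧
      s = ∑ i, ‖p i - q i‖) → geodDist f logp x y w₀ w₁ ≤ C * s := by
    rintro s ⟨n, p, q, hp, hpq, hq, rfl⟩
    rw [geodDist_eq_of_effMk_eq hdiff hcont hlogp w₀ hq]
    exact key n p q hp hpq
  rcases hC.eq_or_lt with rfl | hC'
  · simpa using hle ‖w₀ - w₁‖ ⟨0, fun _ => w₀, fun _ => w₁, rfl, fun i => i.elim0, rfl, by simp⟩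
  · rw [mul_comm, ← div_le_iff₀ hC']
    refine le_csInf ⟨‖w₀ - w₁‖, 0, fun _ => w₀, fun _ => w₁, rfl, fun i => i.elim0, rfl,
      by simp⟩ fun s hs => ?_
    rw [div_le_iff₀ hC', mul_comm]
    exact hle s hs

end GeodDist

/-! ### The quotient distance along curves -/

section QuotDist

variable {D I O N : ℕ} {Y : Type*}

theorem bddBelow_quotDist_set (f : Vec D → Vec I → Vec O) (X : Set (Vec I)) (a b : EffParam f X) :
    BddBelow {s : ℝ | ∃ (n : ℕ) (p q : Fin (n + 1) → Vec D),
      effMk f X (p 0) = a ∧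
      (∀ i : Fin n, effMk f X (p i.succ) = effMk f X (q i.castSucc)) ∧
      effMk f X (q (Fin.last n)) = b ∧ s = ∑ i, ‖p i - q i‖} := by
  refine ⟨0, ?_⟩
  rintro s ⟨n, p, q, -, -, -, rfl⟩
  positivity

theorem exists_chain_of_quotDist_lt {f : Vec D → Vec I → Vec O} {X : Set (Vec I)}
    {a b : EffParam f X} {r : ℝ} (h : quotDist f X a b < r) :
    ∃ (n : ℕ) (p q : Fin (n + 1) → Vec D), effMk f X (p 0) = a ∧
      (∀ i : Fin n, effMk f X (p i.succ) = effMk f X (q i.castSucc)) ∧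
      effMk f X (q (Fin.last n)) = b ∧ ∑ i, ‖p i - q i‖ < r := by
  have hne : {s : ℝ | ∃ (n : ℕ) (p q : Fin (n + 1) → Vec D),
      effMk f X (p 0) = a ∧
      (∀ i : Fin n, effMk f X (p i.succ) = effMk f X (q i.castSucc)) ∧
      effMk f X (q (Fin.last n)) = b ∧ s = ∑ i, ‖p i - q i‖}.Nonempty := by
    obtain ⟨w, rfl⟩ := Quotient.exists_rep a
    obtain ⟨w', rfl⟩ := Quotient.exists_rep b
    exact ⟨_, 0, fun _ => w, fun _ => w', rfl, fun i => i.elim0, rfl, rfl⟩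
  obtain ⟨s, ⟨n, p, q, h1, h2, h3, rfl⟩, hs⟩ := exists_lt_of_csInf_lt hne h
  exact ⟨n, p, q, h1, h2, h3, hs⟩

theorem quotDist_self_nonpos (f : Vec D → Vec I → Vec O) (X : Set (Vec I)) (w : Vec D) :
    quotDist f X (effMk f X w) (effMk f X w) ≤ 0 :=
  csInf_le (bddBelow_quotDist_set _ _ _ _)
    ⟨0, fun _ => w, fun _ => w, rfl, fun i => i.elim0, rfl, by simp⟩

/-- A chain ending in `[w]` is extended by the link from `w` to `w'`. -/
theorem quotDist_le_add_norm_sub (f : Vec D → Vec I → Vec O) (X : Set (Vec I)) (a : EffParam f X)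
    (w w' : Vec D) :
    quotDist f X a (effMk f X w') ≤ quotDist f X a (effMk f X w) + ‖w - w'‖ := by
  refine le_of_forall_pos_lt_add fun ε hε => ?_
  obtain ⟨n, p, q, h1, h2, h3, hs⟩ := exists_chain_of_quotDist_lt (lt_add_of_pos_right _ hε)
  refine lt_of_le_of_lt (b := ∑ i, ‖p i - q i‖ + ‖w - w'‖) ?_ (by linarith)
  refine csInf_le (bddBelow_quotDist_set _ _ _ _)
    ⟨n + 1, Fin.snoc (α := fun _ => Vec D) p w, Fin.snoc (α := fun _ => Vec D) q w', ?_, ?_, ?_, ?_⟩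
  · rw [← h1, ← Fin.castSucc_zero, Fin.snoc_castSucc]
  · intro i
    rw [Fin.snoc_castSucc]
    induction i using Fin.lastCases with
    | last => rw [Fin.succ_last, Fin.snoc_last, h3]
    | cast i => rw [Fin.succ_castSucc, Fin.snoc_castSucc, h2]
  · rw [Fin.snoc_last]
  · symm
    rw [Fin.sum_univ_castSucc]
    simp only [Fin.snoc_castSucc, Fin.snoc_last]

theorem effMk_eq_of_differentiableOn {f : Vec D → Vec I → Vec O} {x : Fin N → Vec I}
    {γ : ℝ → Vec D} (hγ : DifferentiableOn ℝ γ (Icc 0 1))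
    (h : ∀ t ∈ Icc (0 : ℝ) 1, stackedPred f x (γ t) = stackedPred f x (γ 0)) :
    effMk f (range x) (γ 0) = effMk f (range x) (γ 1) := by
  refine Quotient.sound ⟨γ, ⟨⟨1, fun i => i, by simp, by simp, fun i hi => ?_⟩, rfl, rfl⟩,
    fun t ht => (mem_reparam_range_iff f x _ _).2 (h t ht)⟩
  obtain rfl : i = 0 := by omega
  simpa using hγ

/-- If the prediction map is a submersion at `w`, with right inverse `A` of its derivative, then
the points near `w` can be moved along the fibres, by a map that has derivative `A ∘ J` at `w`. -/
theorem exists_fibre_projection {f : Vec D → Vec I → Vec O} {x : Fin N → Vec I}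
    (hF : ContDiff ℝ 1 (stackedPred f x)) (w : Vec D)
    (A : EuclideanSpace ℝ (Fin O × Fin N) →L[ℝ] Vec D)
    (hA : ∀ u, fderiv ℝ (stackedPred f x) w (A u) = u) :
    ∃ Q : Vec D → Vec D, Q w = w ∧ HasFDerivAt Q (A.comp (fderiv ℝ (stackedPred f x) w)) w ∧
      ∀ᶠ w' in 𝓝 w, effMk f (range x) (Q w') = effMk f (range x) w' := by
  set F := stackedPred f x with hFdef
  set J := fderiv ℝ F w with hJdef
  -- A chart straightening the fibres: `J A = id` gives `J (Ψ w') = F w' - F w`, and the derivative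
  -- at `w` is `A J + (id - A J) = id`. The local inverse `Θ` thus carries fibres of `J` into fibres
  -- of `F`.
  let Ψ : Vec D → Vec D := fun w' => A (F w' - F w) + ((w' - w) - A (J (w' - w)))
  have hΨ0 : Ψ w = 0 := by simp [Ψ]
  have hΨ : ContDiff ℝ 1 Ψ := by
    have h1 : ContDiff ℝ 1 fun w' => A (F w' - F w) :=
      A.contDiff.comp (hF.sub contDiff_const)
    have h2 : ContDiff ℝ 1 fun w' => A (J (w' - w)) :=
      A.contDiff.comp (J.contDiff.comp (contDiff_id.sub contDiff_const))
    exact h1.add ((contDiff_id.sub contDiff_const).sub h2)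
  have hFd : HasFDerivAt F J w := (hF.differentiable (by norm_num) w).hasFDerivAt
  have hΨd : HasFDerivAt Ψ ((ContinuousLinearEquiv.refl ℝ (Vec D) : Vec D →L[ℝ] Vec D)) w := by
    have h1 : HasFDerivAt (fun w' => A (F w' - F w)) (A.comp J) w :=
      A.hasFDerivAt.comp w (hFd.sub_const _)
    have h2 : HasFDerivAt (fun w' => w' - w) (ContinuousLinearMap.id ℝ (Vec D)) w :=
      (hasFDerivAt_id w).sub_const _
    have h3 : HasFDerivAt (fun w' => A (J (w' - w))) ((A.comp J).comp (.id ℝ (Vec D))) w :=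
      (A.comp J).hasFDerivAt.comp w h2
    refine (h1.add (h2.sub h3)).congr_fderiv ?_
    ext1 v
    simp
  have hs : HasStrictFDerivAt Ψ ((ContinuousLinearEquiv.refl ℝ (Vec D) : Vec D →L[ℝ] Vec D)) w :=
    hΨ.contDiffAt.hasStrictFDerivAt' hΨd (by norm_num)
  set Θ := hs.localInverse with hΘ
  have hΘ0 : Θ 0 = w := by rw [← hΨ0]; exact hs.localInverse_apply_image
  have hΘc : ContDiffAt ℝ 1 Θ 0 := by
    rw [← hΨ0]; exact hΨ.contDiffAt.to_localInverse hΨd (by norm_num)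
  have hΘd : HasFDerivAt Θ (ContinuousLinearMap.id ℝ (Vec D)) 0 := by
    have := hs.to_localInverse.hasFDerivAt
    rw [hΨ0] at this
    exact this
  have hright : ∀ᶠ z in 𝓝 (0 : Vec D), Ψ (Θ z) = z := by
    rw [← hΨ0]; exact hs.eventually_right_inverse
  have hdiff : ∀ᶠ z in 𝓝 (0 : Vec D), DifferentiableAt ℝ Θ z :=
    (hΘc.eventually (by norm_num)).mono fun z hz => hz.differentiableAt (by norm_num)
  obtain ⟨r, hr, hball⟩ := Metric.eventually_nhds_iff_ball.1 (hright.and hdiff)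
  have hFΘ : ∀ z ∈ Metric.ball (0 : Vec D) r, F (Θ z) - F w = J z := by
    intro z hz
    have h1 := congrArg J (hball z hz).1
    simpa only [Ψ, map_add, map_sub, hA, sub_self, add_zero] using h1
  have hAF : Continuous fun w' => A (F w' - F w) :=
    A.continuous.comp (hF.continuous.sub continuous_const)
  -- `Q` drops from `Ψ w'` the component in the kernel of `J` and returns by `Θ`, whose derivative
  -- at `0` is the identity.
  refine ⟨fun w' => Θ (A (F w' - F w)), by simpa using hΘ0, ?_, ?_⟩
  · have h1 : HasFDerivAt (fun w' => A (F w' - F w)) (A.comp J) w :=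
      A.hasFDerivAt.comp w (hFd.sub_const _)
    have h2 : HasFDerivAt Θ (ContinuousLinearMap.id ℝ (Vec D)) (A (F w - F w)) := by
      simpa using hΘd
    exact h2.comp w h1
  · have e1 : ∀ᶠ w' in 𝓝 w, A (F w' - F w) ∈ Metric.ball (0 : Vec D) r :=
      hAF.continuousAt.eventually_mem (by simpa using Metric.ball_mem_nhds (0 : Vec D) hr)
    have e2 : ∀ᶠ w' in 𝓝 w, Ψ w' ∈ Metric.ball (0 : Vec D) r :=
      hΨ.continuous.continuousAt.eventually_mem
        (by simpa [hΨ0] using Metric.ball_mem_nhds (0 : Vec D) hr)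
    filter_upwards [e1, e2, hs.eventually_left_inverse] with w' h1 h2 h3
    set a := A (F w' - F w) with ha
    -- The segment from `a` to `Ψ w'` stays in one fibre of `J`, so its image under `Θ` is a
    -- differentiable curve from `Q w'` to `w'` in one fibre of `F`.
    have hz : ∀ t ∈ Icc (0 : ℝ) 1, AffineMap.lineMap a (Ψ w') t ∈ Metric.ball (0 : Vec D) r :=
      fun t ht => (convex_ball _ _).lineMap_mem h1 h2 ht
    have hJ : ∀ t : ℝ, J (AffineMap.lineMap a (Ψ w') t) = F w' - F w := by
      intro t
      simp [AffineMap.lineMap_apply_module', Ψ, hA, ha]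
    have := effMk_eq_of_differentiableOn (f := f) (x := x)
      (γ := fun t : ℝ => Θ (AffineMap.lineMap a (Ψ w') t)) (fun t ht => ?_) (fun t ht => ?_)
    · simp only [AffineMap.lineMap_apply_zero, AffineMap.lineMap_apply_one] at this
      rw [this]
      exact congrArg _ h3
    · exact ((hball _ (hz t ht)).2.comp t
        (AffineMap.hasDerivAt_lineMap.differentiableAt)).differentiableWithinAt
    · have h4 := hFΘ _ (hz t ht)
      have h5 := hFΘ _ (hz 0 ⟨le_rfl, zero_le_one⟩)
      rw [hJ] at h4 h5
      exact sub_left_injective (h4.trans h5.symm)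

/-- The quotient distance `h` from `γ 0` is not known to be differentiable along `γ`, but its
increments near `t` are at most those of `q = Q ∘ γ`, with `Q` the fibre projection at `γ t`. So its
right slopes at `t` are asymptotically at most `‖q' t‖ ≤ G (γ t) (γ' t)`, which is enough for
comparison with the integral. -/
theorem quotDist_le_integral {f : Vec D → Vec I → Vec O} {x : Fin N → Vec I}
    (hF : ContDiff ℝ 1 (stackedPred f x)) {G : Vec D → Vec D → ℝ}
    (hG : Continuous fun p : Vec D × Vec D => G p.1 p.2)
    (hA : ∀ w, ∃ A : EuclideanSpace ℝ (Fin O × Fin N) →L[ℝ] Vec D,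
      (∀ u, fderiv ℝ (stackedPred f x) w (A u) = u) ∧
      ∀ v, ‖A (fderiv ℝ (stackedPred f x) w v)‖ ≤ G w v)
    {γ : ℝ → Vec D} (hγ : ContDiffOn ℝ 1 γ (Icc 0 1)) :
    quotDist f (range x) (effMk f (range x) (γ 0)) (effMk f (range x) (γ 1)) ≤
      ∫ t in (0 : ℝ)..1, G (γ t) (derivWithin γ (Icc 0 1) t) := by
  set h := fun t => quotDist f (range x) (effMk f (range x) (γ 0)) (effMk f (range x) (γ t))
    with hh
  have hgc : ContinuousOn (fun t => G (γ t) (derivWithin γ (Icc 0 1) t)) (Icc 0 1) :=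
    hG.comp_continuousOn (hγ.continuousOn.prodMk
      (hγ.continuousOn_derivWithin (uniqueDiffOn_Icc zero_lt_one) le_rfl))
  have hlocal : ∀ t ∈ Icc (0 : ℝ) 1, ∃ (q : ℝ → Vec D) (v : Vec D),
      HasDerivWithinAt q v (Icc 0 1) t ∧ ‖v‖ ≤ G (γ t) (derivWithin γ (Icc 0 1) t) ∧
      ∀ᶠ s in 𝓝[Icc 0 1] t, |h s - h t| ≤ ‖q s - q t‖ := by
    intro t ht
    obtain ⟨A, hA1, hA2⟩ := hA (γ t)
    obtain ⟨Q, hQ0, hQd, hQ⟩ := exists_fibre_projection hF (γ t) A hA1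
    have hγt := (hγ.differentiableOn (by norm_num) t ht).hasDerivWithinAt
    refine ⟨fun s => Q (γ s), _, hQd.comp_hasDerivWithinAt t hγt, hA2 _, ?_⟩
    filter_upwards [hγt.continuousWithinAt.eventually hQ] with s hs
    have h1 := quotDist_le_add_norm_sub f (range x) (effMk f (range x) (γ 0)) (γ t) (Q (γ s))
    have h2 := quotDist_le_add_norm_sub f (range x) (effMk f (range x) (γ 0)) (Q (γ s)) (γ t)
    rw [hs] at h1 h2
    rw [norm_sub_rev] at h1
    rw [hQ0, abs_le]
    constructor <;> simp only [hh] <;> linarith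
  have hcont : ContinuousOn h (Icc 0 1) := by
    intro t ht
    obtain ⟨q, v, hq, -, hqe⟩ := hlocal t ht
    refine tendsto_iff_norm_sub_tendsto_zero.2 ?_
    refine squeeze_zero' (.of_forall fun _ => norm_nonneg _) hqe ?_
    exact tendsto_iff_norm_sub_tendsto_zero.1 hq.continuousWithinAt
  -- Extending the integrand by constants to a continuous function on `ℝ` makes its primitive
  -- differentiable at the end points too.
  set g : ℝ → ℝ := IccExtend zero_le_one
    ((Icc (0 : ℝ) 1).domRestrict fun t => G (γ t) (derivWithin γ (Icc 0 1) t)) with hg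
  have hgI : ∀ t ∈ Icc (0 : ℝ) 1, g t = G (γ t) (derivWithin γ (Icc 0 1) t) := fun t ht =>
    IccExtend_of_mem _ _ ht
  have hgcont : Continuous g := (continuousOn_iff_continuous_domRestrict.1 hgc).Icc_extend'
  have hB : ∀ t, HasDerivAt (fun s => ∫ u in (0 : ℝ)..s, g u) (g t) t := fun t =>
    intervalIntegral.integral_hasDerivAt_right (hgcont.intervalIntegrable _ _)
      (hgcont.stronglyMeasurableAtFilter _ _) hgcont.continuousAt
  have key := image_le_of_liminf_slope_right_le_deriv_boundary hcont
    (B := fun s => ∫ u in (0 : ℝ)..s, g u) (B' := g)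
    (by simpa using quotDist_self_nonpos f (range x) (γ 0))
    (fun t _ => (hB t).continuousAt.continuousWithinAt) (fun t _ => (hB t).hasDerivWithinAt) ?_
    (right_mem_Icc.2 zero_le_one)
  · refine key.trans_eq (intervalIntegral.integral_congr fun t ht => hgI t ?_)
    rwa [uIcc_of_le zero_le_one] at ht
  · intro t ht r hr
    have ht' := Ico_subset_Icc_self ht
    rw [hgI t ht'] at hr
    obtain ⟨q, v, hq, hv, hqe⟩ := hlocal t ht'
    have hmem : Icc (0 : ℝ) 1 ∈ 𝓝[>] t := mem_of_superset (Ioo_mem_nhdsGT ht.2)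
      fun s hs => ⟨ht.1.trans hs.1.le, hs.2.le⟩
    have hle : 𝓝[>] t ≤ 𝓝[Icc 0 1] t := le_inf nhdsWithin_le_nhds (le_principal_iff.2 hmem)
    refine Eventually.frequently ?_
    filter_upwards [hle hqe, hle (hq.limsup_norm_slope_le (hv.trans_lt hr)),
      self_mem_nhdsWithin] with s hs1 hs2 hs3
    have hst : 0 < s - t := sub_pos.2 hs3
    rw [slope_def_field]
    refine lt_of_le_of_lt ?_ hs2
    rw [Real.norm_of_nonneg hst.le, div_eq_inv_mul]
    gcongr
    exact (le_abs_self _).trans hs1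

end QuotDist

/-! ### The comparison of the two distances -/

theorem quotDist_le_geodDist_div_sqrt {D I O N : ℕ} {Y : Type*} {f : Vec D → Vec I → Vec O}
    {logp : Y → Vec O → ℝ} {x : Fin N → Vec I} {y : Fin N → Y} {l : ℝ} (hl : 0 < l)
    (hdiff : ∀ n, Differentiable ℝ (fun w => f w (x n)))
    (hcont : ∀ n, Continuous (fun w => fderiv ℝ (fun v => f v (x n)) w))
    (hlogp : ∀ n, ContDiff ℝ 2 (logp (y n)))
    (hpsd : ∀ w n, (negHessian (logp (y n)) (f w (x n))).PosSemidef)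
    (hntk : ∀ (w : Vec D) (v : EuclideanSpace ℝ (Fin O × Fin N)),
      l * ‖v‖ ≤ ‖Matrix.toEuclideanLin (ntk f logp x y w) v‖) (w₀ w₁ : Vec D) :
    quotDist f (range x) (effMk f (range x) w₀) (effMk f (range x) w₁) ≤
      geodDist f logp x y w₀ w₁ / √l := by
  have hl' : 0 < √l := Real.sqrt_pos.2 hl
  rw [le_div_iff₀ hl']
  refine le_of_forall_pos_lt_add fun ε hε => ?_
  obtain ⟨γ, hγ, rfl, rfl, hlt⟩ := exists_curve_of_geodDist_lt
    (lt_add_of_pos_right (geodDist f logp x y w₀ w₁) hε)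
  refine lt_of_le_of_lt ?_ hlt
  rw [← le_div_iff₀ hl']
  have := quotDist_le_integral (contDiff_stackedPred hdiff hcont)
    (G := fun w v => ggnNorm f logp x y w v / √l)
    ((continuous_ggnNorm hdiff hcont hlogp).div_const _)
    (exists_rightInverse_norm_le_ggnNorm hl hdiff hpsd hntk) (hγ.of_le (by norm_num))
  rwa [intervalIntegral.integral_div] at this

theorem mainTheorem1 {D I O N : ℕ} {Y : Type*}
    (f : Vec D → Vec I → Vec O) (logp : Y → Vec O → ℝ)
    (x : Fin N → Vec I) (y : Fin N → Y) (l L : ℝ)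
    (hdiff : ∀ n, Differentiable ℝ (fun w => f w (x n)))
    (hlip : ∀ n, ∃ K, LipschitzWith K (fun w => fderiv ℝ (fun v => f v (x n)) w))
    (hlogp : ∀ n, ContDiff ℝ 2 (logp (y n)))
    (hpsd : ∀ w n, (negHessian (logp (y n)) (f w (x n))).PosSemidef)
    (hl : 0 < l) (hlL : l ≤ L)
    (hntk : ∀ (w : Vec D) (v : EuclideanSpace ℝ (Fin O × Fin N)),
      l * ‖v‖ ≤ ‖Matrix.toEuclideanLin (ntk f logp x y w) v‖ ∧
        ‖Matrix.toEuclideanLin (ntk f logp x y w) v‖ ≤ L * ‖v‖) :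
    (∀ ε > 0, ∃ δ > 0, ∀ w₀ w₁ : Vec D,
      (quotDist f (range x) (effMk f (range x) w₀) (effMk f (range x) w₁) < δ →
        geodDist f logp x y w₀ w₁ < ε) ∧
      (geodDist f logp x y w₀ w₁ < δ →
        quotDist f (range x) (effMk f (range x) w₀) (effMk f (range x) w₁) < ε)) ∧
    (∀ (w₀ w₁ : Vec D) (δ : ℝ), 0 < δ →
      (quotDist f (range x) (effMk f (range x) w₀) (effMk f (range x) w₁) < δ →
        geodDist f logp x y w₀ w₁ < 3 * √L * δ) ∧
      (geodDist f logp x y w₀ w₁ < δ →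
        quotDist f (range x) (effMk f (range x) w₀) (effMk f (range x) w₁) < 6 * δ / √l)) := by
  have hcont : ∀ n, Continuous (fun w => fderiv ℝ (fun v => f v (x n)) w) := fun n =>
    (hlip n).choose_spec.continuous
  have hL : 0 < L := hl.trans_le hlL
  have hsl : 0 < √l := Real.sqrt_pos.2 hl
  have hsL : 0 < √L := Real.sqrt_pos.2 hL
  have h1 := geodDist_le_mul_quotDist hsL.le hdiff hcont hlogp
    (ggnNorm_le_sqrt_mul_norm hdiff hpsd fun w v => (hntk w v).2)
  have h2 := quotDist_le_geodDist_div_sqrt hl hdiff hcont hlogp hpsd fun w v => (hntk w v).1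
  -- Both estimates hold with constant `1` in place of `3` and `6`; positivity of `δ` absorbs the
  -- difference.
  have key : ∀ (w₀ w₁ : Vec D) (δ : ℝ), 0 < δ →
      (quotDist f (range x) (effMk f (range x) w₀) (effMk f (range x) w₁) < δ →
        geodDist f logp x y w₀ w₁ < 3 * √L * δ) ∧
      (geodDist f logp x y w₀ w₁ < δ →
        quotDist f (range x) (effMk f (range x) w₀) (effMk f (range x) w₁) < 6 * δ / √l) := by
    refine fun w₀ w₁ δ hδ => ⟨fun h => ?_, fun h => ?_⟩
    · have h3 := mul_lt_mul_of_pos_left h hsL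
      have h4 := mul_pos hsL hδ
      linarith [h1 w₀ w₁]
    · refine (h2 w₀ w₁).trans_lt ?_
      gcongr
      linarith
  -- The two entries solve `3 √L δ = ε` and `6 δ / √l = ε`.
  refine ⟨fun ε hε => ⟨min (ε / (3 * √L)) (ε * √l / 6), by positivity, fun w₀ w₁ =>
    ⟨fun h => ?_, fun h => ?_⟩⟩, key⟩
  · refine ((key w₀ w₁ (ε / (3 * √L)) (by positivity)).1 (h.trans_le (min_le_left _ _))).trans_eq ?_
    field_simp
  · refine ((key w₀ w₁ (ε * √l / 6) (by positivity)).2 (h.trans_le (min_le_right _ _))).trans_eq ?_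
    field_simp
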